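/- Let $\alpha\in(0,1)\cup(1,2)$ and let $X$ be a symmetric $\alpha$-stable random variable with Lévy measure $\nu(dx)=|x|^{-\alpha-1}\,dx$ on $\mathbb{R}$, i.e. a real random variable with $$\mathbb{E}\,e^{itX}=\exp\Big(\int_{\mathbb{R}}\psi(t,x)\,|x|^{-\alpha-1}\,dx\Big)\quad(t\in\mathbb{R}),\qquad \psi(t,x)=\begin{cases}e^{itx}-1,&\alpha\in(0,1),\\ e^{itx}-1-itx,&\alpha\in(1,2).\end{cases}$$ Let $y>0$. If $\alpha\in(0,1)$, then $$\mathbb{P}(X\ge y)\le\frac{4}{\alpha y^{\alpha}}\qquad\text{and}\qquad \mathbb{P}(|X|>y)\le\frac{8}{\alpha y^{\alpha}}.$$ For every $\alpha\in(0,1)\cup(1,2)$, $$\mathbb{P}(X\ge y)\ge\frac{1}{2}\cdot\frac{1}{2+\alpha y^{\alpha}}.$$ -/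

import Mathlib

open MeasureTheory

/-- The Lévy measure `ν(dx) = |x| ^ (-α - 1) dx` on the real line (both one-sided constants
equal to `1`). The single point `x = 0` is Lebesgue-null, so the value there is irrelevant. -/
noncomputable def symmLevyMeasure (α : ℝ) : Measure ℝ :=
  volume.withDensity (fun x => ENNReal.ofReal (|x| ^ (-α - 1)))

/-- The integrand of the Lévy–Khintchine exponent of a strictly `α`-stable law:
`e^{itx} - 1` for `α < 1`, and the compensated `e^{itx} - 1 - itx` for `α > 1`. -/
noncomputable def stableKernel (α t x : ℝ) : ℂ :=
  if α < 1 then Complex.exp (Complex.I * t * x) - 1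
  else Complex.exp (Complex.I * t * x) - 1 - Complex.I * t * x

/-- `X` is a symmetric `α`-stable random variable with Lévy measure `|x| ^ (-α - 1) dx`
(used for `α ∈ (0, 1) ∪ (1, 2)`): its characteristic function is
`E e^{itX} = exp (∫ ψ(t, x) ν(dx))`. -/
structure IsSymmStable {Ω : Type*} [MeasurableSpace Ω] (α : ℝ) (X : Ω → ℝ)
    (P : Measure Ω) : Prop where
  aemeasurable : AEMeasurable X P
  charFun_eq : ∀ t : ℝ, charFun (P.map X) t =
    Complex.exp (∫ x, stableKernel α t x ∂(symmLevyMeasure α))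

/-!
Everything rests on the explicit tails of the Lévy measure `ν`, of mass `2 / (α * c ^ α)` outside
radius `c`.

For the upper bound, the law has the real characteristic function `exp (-ψ)` with
`ψ t = ∫ (1 - cos (t x)) ν(dx)`. Splitting this integral at `|x| = 2 / |t|` gives
`ψ t ≤ (4 / α) |t| ^ α`, and since `1 - exp (-ψ) ≤ ψ`, the truncation inequality bounding tails by
averages of `1 - charFun` near the origin applies.

For the lower bound, the law is the weak limit of `n`-fold convolution powers of the symmetric
probability measures obtained by cutting `ν` off near the origin and normalising. Given
that one of the `n` independent symmetric summands has absolute value at least `y`, so does their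
sum with probability at least `1 / 2`, because reversing the signs of all the other summands
preserves the joint law. In the limit a summand of that size occurs with probability
`1 - exp (-2 / (α * y ^ α))`, and `exp x ≥ 1 + x` finishes the proof.
-/

open Filter ProbabilityTheory Topology
open scoped InnerProductSpace

section SymmetricMeasure

variable {G : Type*} [AddCommGroup G] [MeasurableSpace G]

lemma isNegInvariant_dirac_zero [MeasurableNeg G] :
    (Measure.dirac (0 : G)).IsNegInvariant := by
  constructor
  rw [Measure.neg, Measure.map_dirac' measurable_neg, neg_zero]

lemma isNegInvariant_conv [MeasurableAdd₂ G] [MeasurableNeg G] (μ ν : Measure G) [SFinite μ]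
    [SFinite ν] [μ.IsNegInvariant] [ν.IsNegInvariant] : (μ ∗ ν).IsNegInvariant := by
  constructor
  have h := Measure.map_conv_addMonoidHom (μ := μ) (ν := ν) negAddMonoidHom measurable_neg
  rwa [coe_negAddMonoidHom, Measure.map_neg_eq_self μ, Measure.map_neg_eq_self ν] at h

lemma isNegInvariant_restrict [MeasurableNeg G] (μ : Measure G) [μ.IsNegInvariant] {s : Set G}
    (hs : MeasurableSet s) (hneg : Neg.neg ⁻¹' s = s) : (μ.restrict s).IsNegInvariant := by
  constructor
  have h := Measure.restrict_map (μ := μ) measurable_neg hs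
  rw [Measure.map_neg_eq_self, hneg] at h
  exact h.symm

lemma isNegInvariant_cond [MeasurableNeg G] (μ : Measure G) [μ.IsNegInvariant] {s : Set G}
    (hs : MeasurableSet s) (hneg : Neg.neg ⁻¹' s = s) : (μ[|s]).IsNegInvariant := by
  have := isNegInvariant_restrict μ hs hneg
  constructor
  rw [Measure.neg, ProbabilityTheory.cond, Measure.map_smul, Measure.map_neg_eq_self]

lemma isNegInvariant_withDensity [MeasurableNeg G] (μ : Measure G) [μ.IsNegInvariant]
    {f : G → ENNReal} (hf : ∀ x, f (-x) = f x) : (μ.withDensity f).IsNegInvariant := by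
  constructor
  ext s hs
  rw [Measure.neg, Measure.map_apply measurable_neg hs, withDensity_apply _ hs,
    withDensity_apply _ (measurable_neg hs), ← lintegral_indicator hs,
    ← lintegral_indicator (measurable_neg hs), ← lintegral_neg_eq_self (s.indicator f)]
  refine lintegral_congr fun x => ?_
  have h := Set.indicator_comp_right (s := s) (g := f) Neg.neg (x := x)
  rwa [show f ∘ Neg.neg = f from funext hf] at h

lemma integral_eq_of_add_neg_eq_two_smul {E : Type*} [NormedAddCommGroup E] [NormedSpace ℝ E]
    [MeasurableNeg G] {μ : Measure G} [μ.IsNegInvariant] {f g : G → E} (hf : Integrable f μ)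
    (hfg : ∀ x, f x + f (-x) = (2 : ℝ) • g x) : ∫ x, f x ∂μ = ∫ x, g x ∂μ := by
  have h : ∫ x, (f x + f (-x)) ∂μ = (2 : ℝ) • ∫ x, f x ∂μ := by
    rw [integral_add hf hf.comp_neg, integral_neg_eq_self, two_smul]
  simp_rw [hfg, integral_smul] at h
  exact (smul_right_injective E (two_ne_zero (α := ℝ)) h).symm

end SymmetricMeasure

lemma measureReal_le_abs_eq_two_mul {μ : Measure ℝ} [IsFiniteMeasure μ] [μ.IsNegInvariant] {y : ℝ}
    (hy : 0 < y) : μ.real {x | y ≤ |x|} = 2 * μ.real {x | y ≤ x} := by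
  have hset : {x : ℝ | y ≤ |x|} = {x | y ≤ x} ∪ Neg.neg ⁻¹' {x | y ≤ x} :=
    Set.ext fun x => le_abs (a := y) (b := x)
  have hm : MeasurableSet {x : ℝ | y ≤ x} := measurableSet_Ici
  have hd : Disjoint {x : ℝ | y ≤ x} (Neg.neg ⁻¹' {x : ℝ | y ≤ x}) :=
    Set.disjoint_left.mpr fun x (h1 : y ≤ x) (h2 : y ≤ -x) => by linarith
  rw [hset, measureReal_union hd (measurable_neg hm), two_mul, measureReal_def μ (_ ⁻¹' _),
    Measure.measure_preimage_neg, measureReal_def]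

section CharFun

variable {E : Type*} [NormedAddCommGroup E] [InnerProductSpace ℝ E] [MeasurableSpace E]
  [BorelSpace E] [SecondCountableTopology E]

lemma isNegInvariant_of_charFun_neg [CompleteSpace E] {μ : Measure E} [IsFiniteMeasure μ]
    (h : ∀ t, charFun μ (-t) = charFun μ t) : μ.IsNegInvariant := by
  constructor
  have hneg : μ.neg = μ.map (fun x => (-1 : ℝ) • x) := by
    simp only [neg_smul, one_smul]
    rfl
  rw [hneg]
  exact Measure.ext_of_charFun (funext fun t => by rw [charFun_map_smul, neg_one_smul, h])

lemma exp_ofReal_mul_I_add_exp_neg (x : ℝ) :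
    Complex.exp (x * Complex.I) + Complex.exp ((-x : ℝ) * Complex.I) =
      (2 : ℝ) • (Real.cos x : ℂ) := by
  rw [Complex.real_smul, Complex.ofReal_ofNat, Complex.ofReal_cos, Complex.two_cos,
    Complex.ofReal_neg]

lemma integrable_cos_inner (μ : Measure E) [IsFiniteMeasure μ] (t : E) :
    Integrable (fun x => Real.cos ⟪x, t⟫_ℝ) μ :=
  (integrable_const (1 : ℝ)).mono' (by fun_prop)
    (ae_of_all _ fun _ => Real.abs_cos_le_one _)

lemma charFun_eq_integral_cos (μ : Measure E) [IsFiniteMeasure μ] [μ.IsNegInvariant] (t : E) :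
    charFun μ t = (∫ x, Real.cos ⟪x, t⟫_ℝ ∂μ : ℝ) := by
  rw [charFun_apply, ← integral_complex_ofReal]
  refine integral_eq_of_add_neg_eq_two_smul ?_ fun x => ?_
  · exact (integrable_const (1 : ℝ)).mono' (by fun_prop)
      (ae_of_all _ fun x => (Complex.norm_exp_ofReal_mul_I _).le)
  · rw [inner_neg_left, exp_ofReal_mul_I_add_exp_neg]

lemma charFun_cond_eq_one_sub (ν : Measure E) [ν.IsNegInvariant] {s : Set E}
    (hs : MeasurableSet s) (hneg : Neg.neg ⁻¹' s = s) (h0 : ν s ≠ 0) (h1 : ν s ≠ ⊤) (t : E) :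
    charFun (ν[|s]) t =
      ((1 - (∫ x in s, (1 - Real.cos ⟪x, t⟫_ℝ) ∂ν) / ν.real s : ℝ) : ℂ) := by
  have := isNegInvariant_cond ν hs hneg
  have := cond_isProbabilityMeasure_of_finite h0 h1
  have h : ∫ x, (1 - Real.cos ⟪x, t⟫_ℝ) ∂ν[|s] = 1 - ∫ x, Real.cos ⟪x, t⟫_ℝ ∂ν[|s] := by
    rw [integral_sub (integrable_const 1) (integrable_cos_inner _ t), integral_const, probReal_univ,
      one_smul]
  rw [charFun_eq_integral_cos, ← sub_sub_self 1 (∫ x, Real.cos ⟪x, t⟫_ℝ ∂ν[|s]), ← h,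
    ProbabilityTheory.cond, integral_smul_measure, ENNReal.toReal_inv, smul_eq_mul,
    ← measureReal_def, div_eq_inv_mul]

end CharFun

section ConvPow

/-- The `n`-fold convolution power of a measure, that is, the law of a sum of `n` independent
variables with law `ρ`. -/
noncomputable def convPow {M : Type*} [AddMonoid M] [MeasurableSpace M] (ρ : Measure M) :
    ℕ → Measure M
  | 0 => Measure.dirac 0
  | n + 1 => ρ ∗ convPow ρ n

instance isProbabilityMeasure_convPow {M : Type*} [AddMonoid M] [MeasurableSpace M]
    [MeasurableAdd₂ M] (ρ : Measure M) [IsProbabilityMeasure ρ] (n : ℕ) :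
    IsProbabilityMeasure (convPow ρ n) := by
  induction n with
  | zero => unfold convPow; infer_instance
  | succ n ih => unfold convPow; infer_instance

lemma isNegInvariant_convPow {G : Type*} [AddCommGroup G] [MeasurableSpace G] [MeasurableAdd₂ G]
    [MeasurableNeg G] (ρ : Measure G) [IsProbabilityMeasure ρ] [ρ.IsNegInvariant] (n : ℕ) :
    (convPow ρ n).IsNegInvariant := by
  induction n with
  | zero => exact isNegInvariant_dirac_zero
  | succ n ih => exact isNegInvariant_conv ρ (convPow ρ n)

lemma conv_univ {M : Type*} [AddMonoid M] [MeasurableSpace M] [MeasurableAdd₂ M]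
    (μ ν : Measure M) [SFinite ν] : (μ ∗ ν) Set.univ = μ Set.univ * ν Set.univ := by
  rw [Measure.conv, Measure.map_apply (by fun_prop) MeasurableSet.univ, Set.preimage_univ,
    ← Set.univ_prod_univ, Measure.prod_prod]

end ConvPow

section LevyInequality

variable {E : Type*} [SeminormedAddCommGroup E]

lemma neg_preimage_le_norm (y : ℝ) : Neg.neg ⁻¹' {x : E | y ≤ ‖x‖} = {x | y ≤ ‖x‖} := by
  simp only [Set.preimage_ofPred_eq, norm_neg]

variable [MeasurableSpace E]

lemma measurableSet_le_norm [OpensMeasurableSpace E] (y : ℝ) : MeasurableSet {x : E | y ≤ ‖x‖} :=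
  measurableSet_le measurable_const continuous_norm.measurable

variable [NormedSpace ℝ E] [BorelSpace E]

-- Of `x + w` and `x - w`, which `σ` weighs equally, at least one is as long as `x`.
lemma measure_univ_le_two_mul_le_norm_add (σ : Measure E) [σ.IsNegInvariant] {x : E} {y : ℝ}
    (hx : y ≤ ‖x‖) : σ Set.univ ≤ 2 * σ {w | y ≤ ‖x + w‖} := by
  have hneg : σ {w | y ≤ ‖x - w‖} = σ {w | y ≤ ‖x + w‖} := by
    rw [← Measure.measure_preimage_neg σ {w | y ≤ ‖x + w‖}]
    simp only [Set.preimage_ofPred_eq, sub_eq_add_neg]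
  have hcover : Set.univ ⊆ {w | y ≤ ‖x + w‖} ∪ {w | y ≤ ‖x - w‖} := fun w _ => by
    by_contra! hw
    simp only [Set.mem_union, Set.mem_ofPred_eq, not_or, not_le] at hw
    have h : ‖(x + w) + (x - w)‖ ≤ ‖x + w‖ + ‖x - w‖ := norm_add_le _ _
    rw [add_add_sub_cancel, ← two_smul ℝ, norm_smul, Real.norm_two] at h
    linarith
  calc σ Set.univ ≤ σ {w | y ≤ ‖x + w‖} + σ {w | y ≤ ‖x - w‖} :=
        (measure_mono hcover).trans (measure_union_le _ _)
    _ = 2 * σ {w | y ≤ ‖x + w‖} := by rw [hneg, two_mul]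

variable [SecondCountableTopology E]

lemma univ_mul_univ_le_two_mul_conv_le_norm {y : ℝ} (ρ σ : Measure E) [SFinite σ]
    [σ.IsNegInvariant] (hρ : ∀ᵐ x ∂ρ, y ≤ ‖x‖) :
    ρ Set.univ * σ Set.univ ≤ 2 * (ρ ∗ σ) {x | y ≤ ‖x‖} := by
  have hconv : (ρ ∗ σ) {x | y ≤ ‖x‖} = ∫⁻ x, σ {w | y ≤ ‖x + w‖} ∂ρ := by
    rw [Measure.conv, Measure.map_apply (by fun_prop) (measurableSet_le_norm y),
      Measure.prod_apply (measurable_add (measurableSet_le_norm y))]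
    rfl
  calc ρ Set.univ * σ Set.univ = ∫⁻ _, σ Set.univ ∂ρ := by rw [lintegral_const, mul_comm]
    _ ≤ ∫⁻ x, 2 * σ {w | y ≤ ‖x + w‖} ∂ρ :=
      lintegral_mono_ae (hρ.mono fun _ => measure_univ_le_two_mul_le_norm_add σ)
    _ = 2 * (ρ ∗ σ) {x | y ≤ ‖x‖} := by
      rw [hconv, lintegral_const_mul' _ _ ENNReal.ofNat_ne_top]

-- The remainder `τ` makes the induction go through: the first summand is either long, and then
-- everything else is a symmetric perturbation, or short, and then it is absorbed into `τ`.
lemma univ_le_two_mul_conv_convPow_le_norm_add (y : ℝ) (ρ : Measure E) [IsProbabilityMeasure ρ]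
    [ρ.IsNegInvariant] (n : ℕ) (τ : Measure E) [IsFiniteMeasure τ] [τ.IsNegInvariant] :
    τ Set.univ ≤ 2 * (τ ∗ convPow ρ n) {x | y ≤ ‖x‖} +
      τ Set.univ * ρ {x | y ≤ ‖x‖}ᶜ ^ n := by
  induction n generalizing τ with
  | zero => simp
  | succ n ih =>
    set F := {x : E | y ≤ ‖x‖}
    have hF : MeasurableSet F := measurableSet_le_norm y
    have := isNegInvariant_restrict ρ hF.compl (by rw [Set.preimage_compl, neg_preimage_le_norm])
    have := isNegInvariant_conv τ (ρ.restrict Fᶜ)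
    have := isNegInvariant_convPow ρ n
    have := isNegInvariant_conv τ (convPow ρ n)
    have hsplit : τ ∗ convPow ρ (n + 1) =
        (τ ∗ ρ.restrict Fᶜ) ∗ convPow ρ n + ρ.restrict F ∗ (τ ∗ convPow ρ n) := by
      have hρ : convPow ρ (n + 1) = (ρ.restrict F + ρ.restrict Fᶜ) ∗ convPow ρ n := by
        rw [convPow, Measure.restrict_add_restrict_compl hF]
      rw [hρ, Measure.add_conv, Measure.conv_add, ← Measure.conv_assoc, ← Measure.conv_assoc,
        ← Measure.conv_assoc, Measure.conv_comm τ (ρ.restrict F), add_comm]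
    have hshort := ih (τ ∗ ρ.restrict Fᶜ)
    have hlong := univ_mul_univ_le_two_mul_conv_le_norm (ρ.restrict F) (τ ∗ convPow ρ n)
      (ae_restrict_mem hF)
    simp only [conv_univ, Measure.restrict_apply_univ, measure_univ, mul_one] at hshort hlong
    calc τ Set.univ = τ Set.univ * ρ Fᶜ + ρ F * τ Set.univ := by
          rw [mul_comm (ρ F), ← mul_add, add_comm, measure_add_measure_compl hF,
            measure_univ (μ := ρ), mul_one]
      _ ≤ _ := add_le_add hshort hlong
      _ = _ := by
        rw [hsplit, Measure.add_apply]
        ring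

lemma one_sub_one_sub_pow_le_two_mul_convPow_le_norm (y : ℝ) (ρ : Measure E)
    [IsProbabilityMeasure ρ] [ρ.IsNegInvariant] (n : ℕ) :
    1 - (1 - ρ.real {x | y ≤ ‖x‖}) ^ n ≤ 2 * (convPow ρ n).real {x | y ≤ ‖x‖} := by
  have := isNegInvariant_dirac_zero (G := E)
  have h := univ_le_two_mul_conv_convPow_le_norm_add y ρ n (Measure.dirac 0)
  rw [Measure.dirac_zero_conv, measure_univ, one_mul] at h
  have h' := ENNReal.toReal_mono (by finiteness) h
  rw [ENNReal.toReal_add (by finiteness) (by finiteness), ENNReal.toReal_mul, ENNReal.toReal_pow,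
    ENNReal.toReal_one, ENNReal.toReal_ofNat, ← measureReal_def, ← measureReal_def,
    probReal_compl_eq_one_sub (measurableSet_le_norm y)] at h'
  linarith

end LevyInequality

section ArrayLimit

lemma le_measureReal_of_tendsto_of_isClosed {Ω : Type*} [TopologicalSpace Ω] [MeasurableSpace Ω]
    [OpensMeasurableSpace Ω] [HasOuterApproxClosed Ω] {μs : ℕ → ProbabilityMeasure Ω}
    {μ : ProbabilityMeasure Ω} (hμ : Tendsto μs atTop (𝓝 μ)) {F : Set Ω} (hF : IsClosed F)
    {a : ℕ → ℝ} {c : ℝ} (ha : Tendsto a atTop (𝓝 c))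
    (hle : ∀ n, a n ≤ (μs n : Measure Ω).real F) : c ≤ (μ : Measure Ω).real F := by
  rw [measureReal_def, ← ENNReal.ofReal_le_iff_le_toReal (measure_ne_top _ _)]
  calc ENNReal.ofReal c = limsup (fun n => ENNReal.ofReal (a n)) atTop :=
        ((ENNReal.continuous_ofReal.tendsto c).comp ha).limsup_eq.symm
    _ ≤ limsup (fun n => (μs n : Measure Ω) F) atTop :=
        limsup_le_limsup (Eventually.of_forall fun n => ENNReal.ofReal_le_of_le_toReal (hle n))
    _ ≤ (μ : Measure Ω) F := ProbabilityMeasure.limsup_measure_closed_le_of_tendsto hμ hF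

variable {E : Type*} [NormedAddCommGroup E] [InnerProductSpace ℝ E] [MeasurableSpace E]
  [BorelSpace E]

lemma charFun_convPow [SecondCountableTopology E] (ρ : Measure E) [IsProbabilityMeasure ρ] (n : ℕ)
    (t : E) : charFun (convPow ρ n) t = charFun ρ t ^ n := by
  induction n with
  | zero => simp [convPow]
  | succ n ih => rw [convPow, charFun_conv, ih, pow_succ']

lemma tendsto_charFun_convPow [SecondCountableTopology E] {ρ : ℕ → Measure E}
    [∀ n, IsProbabilityMeasure (ρ n)] {t : E} {z : ℂ}
    (h : Tendsto (fun n : ℕ => n * (charFun (ρ n) t - 1)) atTop (𝓝 z)) :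
    Tendsto (fun n => charFun (convPow (ρ n) n) t) atTop (𝓝 (Complex.exp z)) := by
  simpa only [charFun_convPow, add_sub_cancel] using Complex.tendsto_one_add_pow_exp_of_tendsto h

lemma one_sub_exp_neg_le_two_mul_of_tendsto_convPow [FiniteDimensional ℝ E] {ρ : ℕ → Measure E}
    [∀ n, IsProbabilityMeasure (ρ n)] [∀ n, (ρ n).IsNegInvariant] {μ : Measure E}
    [IsProbabilityMeasure μ]
    (hμ : ∀ t, Tendsto (fun n => charFun (convPow (ρ n) n) t) atTop (𝓝 (charFun μ t)))
    {y l : ℝ} (hl : Tendsto (fun n : ℕ => n * (ρ n).real {x | y ≤ ‖x‖}) atTop (𝓝 l)) :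
    1 - Real.exp (-l) ≤ 2 * μ.real {x | y ≤ ‖x‖} := by
  have := FiniteDimensional.proper ℝ E
  let μs : ℕ → ProbabilityMeasure E := fun n => ⟨convPow (ρ n) n, inferInstance⟩
  have hweak : Tendsto μs atTop (𝓝 ⟨μ, inferInstance⟩) :=
    ProbabilityMeasure.tendsto_of_tendsto_charFun hμ
  have hpow : Tendsto (fun n : ℕ => (1 - (ρ n).real {x | y ≤ ‖x‖}) ^ n) atTop
      (𝓝 (Real.exp (-l))) := by
    simpa only [← sub_eq_add_neg] using Real.tendsto_one_add_pow_exp_of_tendsto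
      (g := fun n => -(ρ n).real {x | y ≤ ‖x‖}) (by simpa only [mul_neg] using hl.neg)
  have h := le_measureReal_of_tendsto_of_isClosed hweak
    (isClosed_le continuous_const continuous_norm) ((hpow.const_sub 1).div_const 2) fun n => by
      rw [div_le_iff₀' two_pos]
      exact one_sub_one_sub_pow_le_two_mul_convPow_le_norm y (ρ n) n
  rwa [div_le_iff₀' two_pos] at h

end ArrayLimit

section SymmLevyMeasure

variable {α : ℝ}

instance isNegInvariant_symmLevyMeasure (α : ℝ) : (symmLevyMeasure α).IsNegInvariant :=
  isNegInvariant_withDensity volume fun x => by rw [abs_neg]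

lemma symmLevyMeasure_absolutelyContinuous (α : ℝ) : symmLevyMeasure α ≪ volume :=
  withDensity_absolutelyContinuous _ _

lemma integrable_symmLevyMeasure_iff {f : ℝ → ℝ} :
    Integrable f (symmLevyMeasure α) ↔ Integrable fun x => |x| ^ (-α - 1) * f x := by
  rw [symmLevyMeasure, integrable_withDensity_iff_integrable_smul' (by fun_prop) (by simp)]
  simp_rw [ENNReal.toReal_ofReal (Real.rpow_nonneg (abs_nonneg _) _), smul_eq_mul]

lemma integral_symmLevyMeasure (f : ℝ → ℝ) :
    ∫ x, f x ∂symmLevyMeasure α = ∫ x, |x| ^ (-α - 1) * f x := by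
  rw [symmLevyMeasure, integral_withDensity_eq_integral_toReal_smul (by fun_prop) (by simp)]
  simp_rw [ENNReal.toReal_ofReal (Real.rpow_nonneg (abs_nonneg _) _), smul_eq_mul]

lemma integrable_comp_abs {f : ℝ → ℝ} (hf : IntegrableOn f (Set.Ioi 0)) :
    Integrable (fun x => f |x|) := by
  have hIoi : IntegrableOn (fun x => f |x|) (Set.Ioi 0) :=
    hf.congr_fun (fun x hx => by rw [abs_of_pos hx]) measurableSet_Ioi
  have hIic : IntegrableOn (fun x => f |x|) (Set.Iic 0) := by
    simpa only [abs_neg, Set.neg_Ici, neg_zero] using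
      ((integrableOn_Ici_iff_integrableOn_Ioi (μ := volume)).mpr hIoi).comp_neg
  rw [← integrableOn_univ, ← Set.Iic_union_Ioi (a := (0 : ℝ))]
  exact hIic.union hIoi

lemma levyDensity_mul_indicator_rpow_eqOn (α p : ℝ) (s : Set ℝ) :
    Set.EqOn (fun r : ℝ => r ^ (-α - 1) * s.indicator (· ^ p) r)
      (s.indicator (· ^ (p - α - 1))) (Set.Ioi 0) := by
  intro r hr
  by_cases hs : r ∈ s
  · simp only [Set.indicator_of_mem hs]
    rw [← Real.rpow_add hr]
    ring_nf
  · simp only [Set.indicator_of_notMem hs, mul_zero]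

lemma integrableOn_abs_rpow_symmLevyMeasure {p : ℝ} {s : Set ℝ} (hs : MeasurableSet s)
    (h : IntegrableOn (fun r : ℝ => r ^ (p - α - 1)) (s ∩ Set.Ioi 0)) :
    IntegrableOn (fun x => |x| ^ p) {x | |x| ∈ s} (symmLevyMeasure α) := by
  have hm : MeasurableSet {x : ℝ | |x| ∈ s} := measurable_norm hs
  rw [← integrable_indicator_iff hm, integrable_symmLevyMeasure_iff]
  refine integrable_comp_abs (f := fun r => r ^ (-α - 1) * s.indicator (· ^ p) r) ?_
  rw [integrableOn_congr_fun (levyDensity_mul_indicator_rpow_eqOn α p s) measurableSet_Ioi,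
    IntegrableOn, integrable_indicator_iff hs, IntegrableOn, Measure.restrict_restrict hs]
  exact h

lemma setIntegral_abs_rpow_symmLevyMeasure (α p : ℝ) {s : Set ℝ} (hs : MeasurableSet s) :
    ∫ x in {x | |x| ∈ s}, |x| ^ p ∂symmLevyMeasure α =
      2 * ∫ r in s ∩ Set.Ioi 0, r ^ (p - α - 1) := by
  have hm : MeasurableSet {x : ℝ | |x| ∈ s} := measurable_norm hs
  rw [← integral_indicator hm, integral_symmLevyMeasure]
  refine (integral_comp_abs (f := fun r => r ^ (-α - 1) * s.indicator (· ^ p) r)).trans ?_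
  rw [setIntegral_congr_fun measurableSet_Ioi (levyDensity_mul_indicator_rpow_eqOn α p s),
    integral_indicator hs, Measure.restrict_restrict hs]

variable {c p : ℝ}

lemma measurableSet_le_abs (c : ℝ) : MeasurableSet {x : ℝ | c ≤ |x|} := measurableSet_le_norm c

lemma compl_le_abs (c : ℝ) : {x : ℝ | c ≤ |x|}ᶜ = {x | |x| ∈ Set.Iio c} := by
  simp only [Set.compl_ofPred, not_le, Set.mem_Iio]

lemma integrableOn_abs_rpow_compl_le_abs (hc : 0 < c) (hp : α < p) :
    IntegrableOn (fun x => |x| ^ p) {x | c ≤ |x|}ᶜ (symmLevyMeasure α) := by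
  have h := (intervalIntegral.intervalIntegrable_rpow' (a := 0) (b := c)
    (show -1 < p - α - 1 by linarith))
  rw [intervalIntegrable_iff_integrableOn_Ioo_of_le hc.le] at h
  rw [compl_le_abs]
  exact integrableOn_abs_rpow_symmLevyMeasure measurableSet_Iio
    (by rwa [Set.inter_comm, Set.Ioi_inter_Iio])

lemma setIntegral_abs_rpow_compl_le_abs (hc : 0 < c) (hp : α < p) :
    ∫ x in {x | c ≤ |x|}ᶜ, |x| ^ p ∂symmLevyMeasure α = 2 * (c ^ (p - α) / (p - α)) := by
  rw [compl_le_abs, setIntegral_abs_rpow_symmLevyMeasure α p measurableSet_Iio, Set.inter_comm,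
    Set.Ioi_inter_Iio, ← integral_Ioc_eq_integral_Ioo, ← intervalIntegral.integral_of_le hc.le,
    integral_rpow (Or.inl (by linarith)), sub_add_cancel, Real.zero_rpow (by linarith), sub_zero]

lemma integrableOn_abs_rpow_le_abs (hc : 0 < c) (hp : p < α) :
    IntegrableOn (fun x => |x| ^ p) {x | c ≤ |x|} (symmLevyMeasure α) := by
  have h : IntegrableOn (fun r : ℝ => r ^ (p - α - 1)) (Set.Ici c) :=
    (integrableOn_Ici_iff_integrableOn_Ioi (μ := volume)).mpr
      (integrableOn_Ioi_rpow_of_lt (by linarith) hc)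
  exact integrableOn_abs_rpow_symmLevyMeasure (s := Set.Ici c) measurableSet_Ici
    (h.mono_set Set.inter_subset_left)

lemma setIntegral_abs_rpow_le_abs (hc : 0 < c) (hp : p < α) :
    ∫ x in {x | c ≤ |x|}, |x| ^ p ∂symmLevyMeasure α = 2 * (c ^ (p - α) / (α - p)) := by
  have hset : Set.Ici c ∩ Set.Ioi 0 = Set.Ici c :=
    Set.inter_eq_left.mpr fun _ hr => hc.trans_le hr
  refine (setIntegral_abs_rpow_symmLevyMeasure α p (s := Set.Ici c) measurableSet_Ici).trans ?_
  rw [hset, integral_Ici_eq_integral_Ioi, integral_Ioi_rpow_of_lt (by linarith) hc, sub_add_cancel,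
    neg_div, ← div_neg, neg_sub]

lemma symmLevyMeasure_le_abs_ne_top (hα : 0 < α) (hc : 0 < c) :
    symmLevyMeasure α {x | c ≤ |x|} ≠ ⊤ := by
  have h := integrableOn_abs_rpow_le_abs hc hα
  simp only [Real.rpow_zero] at h
  exact (integrableOn_const_iff (by simp)).mp h |>.resolve_left (by simp) |>.ne

lemma measureReal_symmLevyMeasure_le_abs (hα : 0 < α) (hc : 0 < c) :
    (symmLevyMeasure α).real {x | c ≤ |x|} = 2 / (α * c ^ α) := by
  have h := setIntegral_abs_rpow_le_abs hc hα
  simp only [Real.rpow_zero, setIntegral_const, smul_eq_mul, mul_one, zero_sub, sub_zero,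
    Real.rpow_neg hc.le] at h
  rw [h]
  field_simp

section PowerBound

variable {F : Type*} [NormedAddCommGroup F] {f : ℝ → F} {a b A B : ℝ}

lemma integrable_symmLevyMeasure_of_norm_le_rpow
    (hf : AEStronglyMeasurable f (symmLevyMeasure α)) (hc : 0 < c) (ha : α < a) (hb : b < α)
    (hA : ∀ x, ‖f x‖ ≤ A * |x| ^ a) (hB : ∀ x, c ≤ |x| → ‖f x‖ ≤ B * |x| ^ b) :
    Integrable f (symmLevyMeasure α) := by
  have hlarge : IntegrableOn f {x | c ≤ |x|} (symmLevyMeasure α) :=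
    ((integrableOn_abs_rpow_le_abs hc hb).const_mul B).mono' hf.restrict
      (ae_restrict_of_forall_mem (measurableSet_le_abs c) hB)
  have hsmall : IntegrableOn f {x | c ≤ |x|}ᶜ (symmLevyMeasure α) :=
    ((integrableOn_abs_rpow_compl_le_abs hc ha).const_mul A).mono' hf.restrict (ae_of_all _ hA)
  rw [← integrableOn_univ, ← Set.union_compl_self {x : ℝ | c ≤ |x|}]
  exact hlarge.union hsmall

lemma norm_integral_symmLevyMeasure_le_of_norm_le_rpow [NormedSpace ℝ F]
    (hf : AEStronglyMeasurable f (symmLevyMeasure α)) (hc : 0 < c) (ha : α < a) (hb : b < α)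
    (hA : ∀ x, ‖f x‖ ≤ A * |x| ^ a) (hB : ∀ x, c ≤ |x| → ‖f x‖ ≤ B * |x| ^ b) :
    ‖∫ x, f x ∂symmLevyMeasure α‖ ≤
      2 * (A * (c ^ (a - α) / (a - α)) + B * (c ^ (b - α) / (α - b))) := by
  have hlarge : ‖∫ x in {x | c ≤ |x|}, f x ∂symmLevyMeasure α‖ ≤
      B * (2 * (c ^ (b - α) / (α - b))) := by
    rw [← setIntegral_abs_rpow_le_abs hc hb, ← integral_const_mul]
    exact norm_integral_le_of_norm_le ((integrableOn_abs_rpow_le_abs hc hb).const_mul B)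
      (ae_restrict_of_forall_mem (measurableSet_le_abs c) hB)
  have hsmall : ‖∫ x in {x | c ≤ |x|}ᶜ, f x ∂symmLevyMeasure α‖ ≤
      A * (2 * (c ^ (a - α) / (a - α))) := by
    rw [← setIntegral_abs_rpow_compl_le_abs hc ha, ← integral_const_mul]
    exact norm_integral_le_of_norm_le ((integrableOn_abs_rpow_compl_le_abs hc ha).const_mul A)
      (ae_of_all _ hA)
  rw [← integral_add_compl (measurableSet_le_abs c)
    (integrable_symmLevyMeasure_of_norm_le_rpow hf hc ha hb hA hB)]
  linarith [norm_add_le (∫ x in {x | c ≤ |x|}, f x ∂symmLevyMeasure α)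
    (∫ x in {x | c ≤ |x|}ᶜ, f x ∂symmLevyMeasure α)]

end PowerBound

end SymmLevyMeasure

section StableKernel

lemma norm_exp_I_mul_ofReal_sub_one_le_two (x : ℝ) : ‖Complex.exp (Complex.I * x) - 1‖ ≤ 2 := by
  refine (norm_sub_le _ _).trans ?_
  rw [mul_comm, Complex.norm_exp_ofReal_mul_I, norm_one, one_add_one_eq_two]

lemma norm_exp_I_mul_ofReal_sub_one_sub_le (x : ℝ) :
    ‖Complex.exp (Complex.I * x) - 1 - Complex.I * x‖ ≤ 2 * |x| := by
  have h := norm_sub_le (Complex.exp (Complex.I * x) - 1) (Complex.I * x)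
  rw [norm_mul, Complex.norm_I, one_mul, Complex.norm_real, Real.norm_eq_abs] at h
  linarith [Real.norm_exp_I_mul_ofReal_sub_one_le (x := x), Real.norm_eq_abs x]

lemma norm_exp_I_mul_ofReal_sub_one_sub_le_sq (x : ℝ) :
    ‖Complex.exp (Complex.I * x) - 1 - Complex.I * x‖ ≤ 2 * x ^ 2 := by
  rcases le_total |x| 1 with hx | hx
  · have hn : ‖Complex.I * (x : ℂ)‖ = |x| := by
      rw [norm_mul, Complex.norm_I, one_mul, Complex.norm_real, Real.norm_eq_abs]
    have h := Complex.norm_exp_sub_one_sub_id_le (hn.trans_le hx)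
    rw [hn, sq_abs] at h
    linarith [sq_nonneg x]
  · calc _ ≤ 2 * |x| := norm_exp_I_mul_ofReal_sub_one_sub_le x
      _ ≤ 2 * x ^ 2 := by
        rw [← sq_abs]
        gcongr
        exact le_self_pow₀ hx two_ne_zero

variable {α : ℝ}

lemma stableKernel_of_lt_one (hα : α < 1) (t x : ℝ) :
    stableKernel α t x = Complex.exp (Complex.I * (t * x : ℝ)) - 1 := by
  rw [stableKernel, if_pos hα, Complex.ofReal_mul, mul_assoc]

lemma stableKernel_of_one_le (hα : 1 ≤ α) (t x : ℝ) :
    stableKernel α t x =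
      Complex.exp (Complex.I * (t * x : ℝ)) - 1 - Complex.I * (t * x : ℝ) := by
  rw [stableKernel, if_neg hα.not_gt, Complex.ofReal_mul, mul_assoc]

lemma aestronglyMeasurable_stableKernel (α t : ℝ) (μ : Measure ℝ) :
    AEStronglyMeasurable (stableKernel α t) μ := by
  unfold stableKernel
  split_ifs <;> fun_prop

lemma integrable_stableKernel (hα : α ∈ Set.Ioo (0 : ℝ) 1 ∪ Set.Ioo (1 : ℝ) 2) (t : ℝ) :
    Integrable (stableKernel α t) (symmLevyMeasure α) := by
  have hmeas := aestronglyMeasurable_stableKernel α t (symmLevyMeasure α)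
  rcases hα with ⟨h0, h1⟩ | ⟨h1, h2⟩
  · refine integrable_symmLevyMeasure_of_norm_le_rpow (A := |t|) (B := 2) hmeas one_pos h1 h0
      (fun x => ?_) fun x _ => ?_
    · rw [stableKernel_of_lt_one h1, Real.rpow_one, ← abs_mul, ← Real.norm_eq_abs]
      exact Real.norm_exp_I_mul_ofReal_sub_one_le
    · rw [stableKernel_of_lt_one h1, Real.rpow_zero, mul_one]
      exact norm_exp_I_mul_ofReal_sub_one_le_two _
  · refine integrable_symmLevyMeasure_of_norm_le_rpow (A := 2 * t ^ 2) (B := 2 * |t|) hmeas one_pos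
      h2 h1 (fun x => ?_) fun x _ => ?_
    · rw [stableKernel_of_one_le h1.le, Real.rpow_two, sq_abs, mul_assoc, ← mul_pow]
      exact norm_exp_I_mul_ofReal_sub_one_sub_le_sq _
    · rw [stableKernel_of_one_le h1.le, Real.rpow_one, mul_assoc, ← abs_mul]
      exact norm_exp_I_mul_ofReal_sub_one_sub_le _

lemma stableKernel_add_neg (α t x : ℝ) :
    stableKernel α t x + stableKernel α t (-x) =
      (2 : ℝ) • ((-(1 - Real.cos (t * x)) : ℝ) : ℂ) := by
  have h := exp_ofReal_mul_I_add_exp_neg (t * x)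
  rw [mul_comm _ Complex.I, mul_comm _ Complex.I, ← mul_neg, Complex.real_smul] at h
  rw [Complex.real_smul]
  rcases lt_or_ge α 1 with hα | hα
  · simp only [stableKernel_of_lt_one hα]
    push_cast at h ⊢
    linear_combination h
  · simp only [stableKernel_of_one_le hα]
    push_cast at h ⊢
    linear_combination h

end StableKernel

section LevyExponent

/-- The Lévy–Khintchine exponent `∫ (1 - cos (t x)) |x| ^ (-α - 1) dx` of the symmetric `α`-stable
law, in the sign convention that makes it nonnegative. The real integrand needs no compensator, so
that one formula serves all `0 < α < 2`. -/
noncomputable def levyExponent (α t : ℝ) : ℝ :=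
  ∫ x, (1 - Real.cos (t * x)) ∂symmLevyMeasure α

lemma levyExponent_nonneg (α t : ℝ) : 0 ≤ levyExponent α t :=
  integral_nonneg fun _ => sub_nonneg.mpr (Real.cos_le_one _)

lemma levyExponent_neg (α t : ℝ) : levyExponent α (-t) = levyExponent α t := by
  simp only [levyExponent, neg_mul, Real.cos_neg]

variable {α : ℝ}

lemma integral_stableKernel (hα : α ∈ Set.Ioo (0 : ℝ) 1 ∪ Set.Ioo (1 : ℝ) 2) (t : ℝ) :
    ∫ x, stableKernel α t x ∂symmLevyMeasure α = -(levyExponent α t : ℂ) := by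
  rw [levyExponent, ← Complex.ofReal_neg, ← integral_neg, ← integral_complex_ofReal]
  exact integral_eq_of_add_neg_eq_two_smul (integrable_stableKernel hα t) (stableKernel_add_neg α t)

lemma norm_one_sub_cos_le_rpow_two (t x : ℝ) :
    ‖1 - Real.cos (t * x)‖ ≤ t ^ 2 / 2 * |x| ^ (2 : ℝ) := by
  rw [Real.norm_of_nonneg (sub_nonneg.mpr (Real.cos_le_one _)), Real.rpow_two, sq_abs]
  linarith [Real.one_sub_sq_div_two_le_cos (x := t * x), mul_pow t x 2]

lemma norm_one_sub_cos_le_rpow_zero (t x : ℝ) :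
    ‖1 - Real.cos (t * x)‖ ≤ 2 * |x| ^ (0 : ℝ) := by
  rw [Real.norm_of_nonneg (sub_nonneg.mpr (Real.cos_le_one _)), Real.rpow_zero]
  linarith [Real.neg_one_le_cos (t * x)]

lemma integrable_one_sub_cos (h0 : 0 < α) (h2 : α < 2) (t : ℝ) :
    Integrable (fun x => 1 - Real.cos (t * x)) (symmLevyMeasure α) :=
  integrable_symmLevyMeasure_of_norm_le_rpow (by fun_prop) one_pos h2 h0
    (norm_one_sub_cos_le_rpow_two t) fun x _ => norm_one_sub_cos_le_rpow_zero t x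

lemma two_rpow_le_one_add {p : ℝ} (hp0 : 0 ≤ p) (hp1 : p ≤ 1) : (2 : ℝ) ^ p ≤ 1 + p := by
  simpa only [one_add_one_eq_two, mul_one] using
    rpow_one_add_le_one_add_mul_self (s := 1) (by norm_num) hp0 hp1

-- The cut-off radius `2 / |t|` is where the bounds `(t x) ^ 2 / 2` and `2` on the integrand cross.
lemma levyExponent_le (h0 : 0 < α) (h1 : α ≤ 1) (t : ℝ) :
    levyExponent α t ≤ 4 / α * |t| ^ α := by
  rcases eq_or_ne t 0 with rfl | ht
  · simp [levyExponent, Real.zero_rpow h0.ne']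
  have ht' : 0 < |t| := abs_pos.mpr ht
  have htα : |t| ^ α ≠ 0 := (Real.rpow_pos_of_pos ht' α).ne'
  have hα2 : 0 < 2 - α := by linarith
  have hsmall : (2 / |t|) ^ (2 - α) = 2 * 2 ^ (1 - α) * |t| ^ α / t ^ 2 := by
    rw [Real.div_rpow two_pos.le ht'.le, Real.rpow_sub ht', Real.rpow_two, sq_abs,
      show (2 : ℝ) - α = 1 + (1 - α) by ring, Real.rpow_add two_pos, Real.rpow_one]
    field_simp
  have hlarge : (2 / |t|) ^ (0 - α) = 2 ^ (1 - α) * |t| ^ α / 2 := by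
    rw [Real.div_rpow two_pos.le ht'.le, zero_sub, Real.rpow_neg ht'.le, Real.rpow_neg two_pos.le,
      Real.rpow_sub two_pos, Real.rpow_one]
    field_simp
  have hfactor : (2 : ℝ) ^ (1 - α) / (2 - α) ≤ 1 := by
    rw [div_le_one hα2]
    linarith [two_rpow_le_one_add (sub_nonneg.mpr h1) (sub_le_self 1 h0.le)]
  calc levyExponent α t
      ≤ 2 * (t ^ 2 / 2 * ((2 / |t|) ^ (2 - α) / (2 - α)) +
          2 * ((2 / |t|) ^ (0 - α) / (α - 0))) :=
        (le_abs_self _).trans <| norm_integral_symmLevyMeasure_le_of_norm_le_rpow (by fun_prop)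
          (div_pos two_pos ht') (by linarith) h0 (norm_one_sub_cos_le_rpow_two t)
          fun x _ => norm_one_sub_cos_le_rpow_zero t x
    _ = 4 / α * |t| ^ α * (2 ^ (1 - α) / (2 - α)) := by
      rw [hsmall, hlarge, sub_zero]
      field_simp
      ring
    _ ≤ 4 / α * |t| ^ α := mul_le_of_le_one_right (by positivity) hfactor

end LevyExponent

section Truncation

lemma intervalIntegral_abs_rpow {a p : ℝ} (ha : 0 ≤ a) (hp : 0 ≤ p) :
    ∫ t in -a..a, |t| ^ p = 2 * (a ^ (p + 1) / (p + 1)) := by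
  have hcont : Continuous fun t : ℝ => |t| ^ p := continuous_abs.rpow_const fun _ => Or.inr hp
  have hpos : ∫ t in (0 : ℝ)..a, |t| ^ p = a ^ (p + 1) / (p + 1) := by
    rw [intervalIntegral.integral_congr (g := (· ^ p)), integral_rpow (Or.inl (by linarith)),
      Real.zero_rpow (by linarith), sub_zero]
    intro t ht
    rw [Set.uIcc_of_le ha] at ht
    simp only [abs_of_nonneg ht.1]
  have hneg : ∫ t in -a..0, |t| ^ p = ∫ t in (0 : ℝ)..a, |t| ^ p := by
    simpa only [abs_neg, neg_zero] using
      (intervalIntegral.integral_comp_neg (a := 0) (b := a) fun t : ℝ => |t| ^ p).symm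
  rw [← intervalIntegral.integral_add_adjacent_intervals (b := 0)
    (hcont.intervalIntegrable _ _) (hcont.intervalIntegrable _ _), hneg, hpos, two_mul]

variable {α C : ℝ} {μ : Measure ℝ} [IsProbabilityMeasure μ]

lemma measureReal_lt_abs_le_of_charFun {r : ℝ} (h0 : 0 ≤ α) (h1 : α ≤ 1) (hr : 0 < r)
    (h : ∀ t, ‖1 - charFun μ t‖ ≤ C * |t| ^ α) : μ.real {x | r < |x|} ≤ 2 * C / r ^ α := by
  have hC : 0 ≤ C := by simpa using (norm_nonneg _).trans (h 1)
  have hu : 0 < 2 * r⁻¹ := by positivity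
  have hcont : Continuous fun t : ℝ => C * |t| ^ α :=
    continuous_const.mul (continuous_abs.rpow_const fun _ => Or.inr h0)
  calc μ.real {x | r < |x|}
      ≤ 2⁻¹ * r * ‖∫ t in (-2 * r⁻¹)..(2 * r⁻¹), 1 - charFun μ t‖ :=
        measureReal_abs_gt_le_integral_charFun hr
    _ ≤ 2⁻¹ * r * ∫ t in -(2 * r⁻¹)..(2 * r⁻¹), C * |t| ^ α := by
      rw [← neg_mul]
      gcongr
      exact intervalIntegral.norm_integral_le_of_norm_le (by linarith) (ae_of_all _ fun t _ => h t)
        (hcont.intervalIntegrable _ _)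
    _ = 2 * C / r ^ α * (2 ^ α / (1 + α)) := by
      rw [intervalIntegral.integral_const_mul, intervalIntegral_abs_rpow hu.le h0,
        Real.rpow_add hu, Real.rpow_one, Real.mul_rpow two_pos.le (inv_nonneg.mpr hr.le),
        Real.inv_rpow hr.le]
      field_simp
      ring
    _ ≤ 2 * C / r ^ α :=
      mul_le_of_le_one_right (by positivity)
        ((div_le_one (by linarith)).mpr (two_rpow_le_one_add h0 h1))

lemma measureReal_le_abs_le_of_charFun {y : ℝ} (h0 : 0 ≤ α) (h1 : α ≤ 1) (hy : 0 < y)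
    (h : ∀ t, ‖1 - charFun μ t‖ ≤ C * |t| ^ α) : μ.real {x | y ≤ |x|} ≤ 2 * C / y ^ α := by
  have hlim : Tendsto (fun r : ℝ => 2 * C / r ^ α) (𝓝[<] y) (𝓝 (2 * C / y ^ α)) :=
    tendsto_nhdsWithin_of_tendsto_nhds <| (continuousAt_const.div
      (Real.continuousAt_rpow_const _ _ (Or.inl hy.ne')) (by positivity)).tendsto
  refine ge_of_tendsto hlim ?_
  filter_upwards [Ioo_mem_nhdsLT hy] with r hr
  exact (measureReal_mono fun x hx => hr.2.trans_le hx).trans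
    (measureReal_lt_abs_le_of_charFun h0 h1 hr.1 h)

end Truncation

/-- The symmetric `α`-stable law with Lévy measure `|x| ^ (-α - 1) dx`, given by its characteristic
function. Unlike `IsSymmStable` this includes the Cauchy case `α = 1`. -/
def IsSymmStableLaw (α : ℝ) (μ : Measure ℝ) : Prop :=
  ∀ t, charFun μ t = Complex.exp (-(levyExponent α t : ℂ))

lemma IsSymmStable.isSymmStableLaw_map {Ω : Type*} [MeasurableSpace Ω] {P : Measure Ω} {α : ℝ}
    {X : Ω → ℝ} (hX : IsSymmStable α X P)
    (hα : α ∈ Set.Ioo (0 : ℝ) 1 ∪ Set.Ioo (1 : ℝ) 2) : IsSymmStableLaw α (P.map X) := fun t => by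
  rw [hX.charFun_eq, integral_stableKernel hα]

namespace IsSymmStableLaw

variable {α : ℝ} {μ : Measure ℝ}

lemma isNegInvariant [IsFiniteMeasure μ] (hμ : IsSymmStableLaw α μ) : μ.IsNegInvariant :=
  isNegInvariant_of_charFun_neg fun t => by rw [hμ, hμ, levyExponent_neg]

lemma norm_one_sub_charFun_le (hμ : IsSymmStableLaw α μ) (t : ℝ) :
    ‖1 - charFun μ t‖ ≤ levyExponent α t := by
  have hexp : 1 - charFun μ t = ((1 - Real.exp (-levyExponent α t) : ℝ) : ℂ) := by
    rw [hμ]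
    push_cast
    rfl
  have h0 : 0 ≤ 1 - Real.exp (-levyExponent α t) :=
    sub_nonneg.mpr (Real.exp_le_one_iff.mpr (neg_nonpos.mpr (levyExponent_nonneg α t)))
  rw [hexp, Complex.norm_real, Real.norm_of_nonneg h0]
  linarith [Real.one_sub_le_exp_neg (levyExponent α t)]

lemma measureReal_le_abs_le [IsProbabilityMeasure μ] {y : ℝ} (hμ : IsSymmStableLaw α μ)
    (h0 : 0 < α) (h1 : α ≤ 1) (hy : 0 < y) : μ.real {x | y ≤ |x|} ≤ 8 / (α * y ^ α) := by
  refine (measureReal_le_abs_le_of_charFun h0.le h1 hy fun t =>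
    (hμ.norm_one_sub_charFun_le t).trans (levyExponent_le h0 h1 t)).trans_eq ?_
  field_simp
  norm_num

end IsSymmStableLaw

section Cutoff

/-- The radius outside which `symmLevyMeasure α` has mass `n + 1`, shifted by one so that no
division by zero occurs at `n = 0`. -/
noncomputable def cutoffRadius (α : ℝ) (n : ℕ) : ℝ := (2 / (α * (n + 1))) ^ α⁻¹

/-- The normalised restriction of `symmLevyMeasure α` to jumps of size at least `cutoffRadius α n`.
Its `n`-fold convolution powers approximate the symmetric `α`-stable law. -/
noncomputable def cutoffLaw (α : ℝ) (n : ℕ) : Measure ℝ :=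
  (symmLevyMeasure α)[|{x | cutoffRadius α n ≤ |x|}]

variable {α : ℝ}

lemma cutoffRadius_pos (h0 : 0 < α) (n : ℕ) : 0 < cutoffRadius α n := by
  unfold cutoffRadius
  positivity

lemma tendsto_cutoffRadius (h0 : 0 < α) : Tendsto (cutoffRadius α) atTop (𝓝 0) := by
  have h : Tendsto (fun n : ℕ => 2 / (α * ((n : ℝ) + 1))) atTop (𝓝 0) :=
    tendsto_const_nhds.div_atTop
      ((tendsto_atTop_add_const_right _ 1 tendsto_natCast_atTop_atTop).const_mul_atTop h0)
  have hpow := h.rpow_const (p := α⁻¹) (Or.inr (by positivity))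
  rwa [Real.zero_rpow (by positivity)] at hpow

lemma aecover_le_abs_cutoffRadius (h0 : 0 < α) :
    AECover (symmLevyMeasure α) atTop fun n => {x | cutoffRadius α n ≤ |x|} where
  ae_eventually_mem := by
    filter_upwards [(symmLevyMeasure_absolutelyContinuous α).ae_le (Measure.ae_ne volume 0)]
      with x hx
    exact (tendsto_cutoffRadius h0).eventually_le_const (abs_pos.mpr hx)
  measurableSet n := measurableSet_le_abs (cutoffRadius α n)

lemma measureReal_symmLevyMeasure_cutoffRadius_le_abs (h0 : 0 < α) (n : ℕ) :
    (symmLevyMeasure α).real {x | cutoffRadius α n ≤ |x|} = n + 1 := by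
  rw [measureReal_symmLevyMeasure_le_abs h0 (cutoffRadius_pos h0 n), cutoffRadius,
    Real.rpow_inv_rpow (by positivity) h0.ne']
  field_simp

lemma symmLevyMeasure_cutoffRadius_le_abs_ne_zero (h0 : 0 < α) (n : ℕ) :
    symmLevyMeasure α {x | cutoffRadius α n ≤ |x|} ≠ 0 := fun h => by
  have hmass := measureReal_symmLevyMeasure_cutoffRadius_le_abs h0 n
  rw [measureReal_def, h, ENNReal.toReal_zero] at hmass
  exact n.cast_add_one_ne_zero hmass.symm

lemma isProbabilityMeasure_cutoffLaw (h0 : 0 < α) (n : ℕ) : IsProbabilityMeasure (cutoffLaw α n) :=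
  cond_isProbabilityMeasure_of_finite (symmLevyMeasure_cutoffRadius_le_abs_ne_zero h0 n)
    (symmLevyMeasure_le_abs_ne_top h0 (cutoffRadius_pos h0 n))

lemma isNegInvariant_cutoffLaw (α : ℝ) (n : ℕ) : (cutoffLaw α n).IsNegInvariant :=
  isNegInvariant_cond _ (measurableSet_le_abs _) (neg_preimage_le_norm _)

lemma charFun_cutoffLaw (h0 : 0 < α) (n : ℕ) (t : ℝ) :
    charFun (cutoffLaw α n) t =
      ((1 - (∫ x in {x | cutoffRadius α n ≤ |x|}, (1 - Real.cos (t * x)) ∂symmLevyMeasure α) /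
        (n + 1) : ℝ) : ℂ) := by
  have h := charFun_cond_eq_one_sub (symmLevyMeasure α) (measurableSet_le_abs _)
    (neg_preimage_le_norm _) (symmLevyMeasure_cutoffRadius_le_abs_ne_zero h0 n)
    (symmLevyMeasure_le_abs_ne_top h0 (cutoffRadius_pos h0 n)) t
  simpa only [cutoffLaw, RCLike.inner_apply, conj_trivial, Real.norm_eq_abs,
    measureReal_symmLevyMeasure_cutoffRadius_le_abs h0 n] using h

lemma tendsto_mul_charFun_cutoffLaw_sub_one (h0 : 0 < α) (h2 : α < 2) (t : ℝ) :
    Tendsto (fun n : ℕ => n * (charFun (cutoffLaw α n) t - 1)) atTop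
      (𝓝 (-(levyExponent α t : ℂ))) := by
  have hint : Tendsto (fun n : ℕ =>
      ∫ x in {x | cutoffRadius α n ≤ |x|}, (1 - Real.cos (t * x)) ∂symmLevyMeasure α) atTop
      (𝓝 (levyExponent α t)) :=
    (aecover_le_abs_cutoffRadius h0).integral_tendsto_of_countably_generated
      (integrable_one_sub_cos h0 h2 t)
  have hlim := ((tendsto_natCast_div_add_atTop (1 : ℝ)).mul hint).neg.ofReal
  rw [one_mul, Complex.ofReal_neg] at hlim
  refine hlim.congr fun n => ?_
  rw [charFun_cutoffLaw h0]
  push_cast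
  ring

lemma measureReal_cutoffLaw_le_abs (h0 : 0 < α) {n : ℕ} {y : ℝ} (hy : cutoffRadius α n ≤ y) :
    (cutoffLaw α n).real {x | y ≤ |x|} = 2 / (α * y ^ α) / (n + 1) := by
  have hsub : {x : ℝ | y ≤ |x|} ⊆ {x | cutoffRadius α n ≤ |x|} := fun x hx => hy.trans hx
  rw [measureReal_def, cutoffLaw, cond_apply (measurableSet_le_abs _), Set.inter_eq_right.mpr hsub,
    ENNReal.toReal_mul, ENNReal.toReal_inv, ← measureReal_def, ← measureReal_def,
    measureReal_symmLevyMeasure_cutoffRadius_le_abs h0,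
    measureReal_symmLevyMeasure_le_abs h0 ((cutoffRadius_pos h0 n).trans_le hy), inv_mul_eq_div]

lemma tendsto_mul_measureReal_cutoffLaw_le_abs (h0 : 0 < α) {y : ℝ} (hy : 0 < y) :
    Tendsto (fun n : ℕ => n * (cutoffLaw α n).real {x | y ≤ |x|}) atTop
      (𝓝 (2 / (α * y ^ α))) := by
  have hlim := (tendsto_natCast_div_add_atTop (1 : ℝ)).mul_const (2 / (α * y ^ α))
  rw [one_mul] at hlim
  refine hlim.congr' ?_
  filter_upwards [(tendsto_cutoffRadius h0).eventually_le_const hy] with n hn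
  rw [measureReal_cutoffLaw_le_abs h0 hn]
  ring

end Cutoff

namespace IsSymmStableLaw

variable {α y : ℝ} {μ : Measure ℝ} [IsProbabilityMeasure μ]

lemma one_sub_exp_neg_le (hμ : IsSymmStableLaw α μ) (h0 : 0 < α) (h2 : α < 2) (hy : 0 < y) :
    1 - Real.exp (-(2 / (α * y ^ α))) ≤ 2 * μ.real {x | y ≤ |x|} := by
  have := isProbabilityMeasure_cutoffLaw h0
  have := isNegInvariant_cutoffLaw α
  refine one_sub_exp_neg_le_two_mul_of_tendsto_convPow (ρ := cutoffLaw α) (fun t => ?_)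
    (tendsto_mul_measureReal_cutoffLaw_le_abs h0 hy)
  rw [hμ t]
  exact tendsto_charFun_convPow (tendsto_mul_charFun_cutoffLaw_sub_one h0 h2 t)

lemma le_measureReal_le_abs (hμ : IsSymmStableLaw α μ) (h0 : 0 < α) (h2 : α < 2) (hy : 0 < y) :
    1 / (2 + α * y ^ α) ≤ μ.real {x | y ≤ |x|} := by
  set u := α * y ^ α
  have hu : 0 < u := by positivity
  have hexp : Real.exp (-(2 / u)) ≤ u / (2 + u) := by
    rw [Real.exp_neg, ← inv_div (2 + u), add_div, div_self hu.ne']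
    exact inv_anti₀ (by positivity) (Real.add_one_le_exp _)
  have hfrac : 1 - u / (2 + u) = 2 * (1 / (2 + u)) := by
    field_simp
    ring
  linarith [hμ.one_sub_exp_neg_le h0 h2 hy]

end IsSymmStableLaw

theorem theorem7_general {Ω : Type*} [MeasurableSpace Ω] (P : Measure Ω) [IsProbabilityMeasure P]
    (α : ℝ) (hα : α ∈ Set.Ioo (0 : ℝ) 2) (X : Ω → ℝ) (hX : AEMeasurable X P)
    (hlaw : IsSymmStableLaw α (P.map X)) (y : ℝ) (hy : 0 < y) :
    (α ≤ 1 →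
      P.real {ω | y ≤ X ω} ≤ 4 / (α * y ^ α) ∧
      P.real {ω | y < |X ω|} ≤ 8 / (α * y ^ α)) ∧
    1 / (2 * (2 + α * y ^ α)) ≤ P.real {ω | y ≤ X ω} := by
  have := Measure.isProbabilityMeasure_map hX
  have := hlaw.isNegInvariant
  have hone : P.real {ω | y ≤ X ω} = (P.map X).real {x | y ≤ |x|} / 2 := by
    rw [measureReal_le_abs_eq_two_mul hy, mul_div_cancel_left₀ _ two_ne_zero]
    exact (map_measureReal_apply_of_aemeasurable hX measurableSet_Ici).symm
  have htwo : P.real {ω | y < |X ω|} ≤ (P.map X).real {x | y ≤ |x|} := by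
    rw [map_measureReal_apply_of_aemeasurable hX (measurableSet_le_abs y)]
    exact measureReal_mono fun ω (hω : y < |X ω|) => hω.le
  rw [hone]
  refine ⟨fun h1 => ?_, ?_⟩
  · have hupper := hlaw.measureReal_le_abs_le hα.1 h1 hy
    refine ⟨?_, htwo.trans hupper⟩
    calc _ ≤ 8 / (α * y ^ α) / 2 := by gcongr
      _ = 4 / (α * y ^ α) := by ring
  · rw [← one_div_mul_one_div_rev, mul_one_div]
    gcongr
    exact hlaw.le_measureReal_le_abs hα.1 hα.2 hy

theorem theorem7 {Ω : Type*} [MeasurableSpace Ω] (P : Measure Ω) [IsProbabilityMeasure P]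
    (α : ℝ) (hα : α ∈ Set.Ioo (0 : ℝ) 1 ∪ Set.Ioo (1 : ℝ) 2)
    (X : Ω → ℝ) (hX : IsSymmStable α X P) (y : ℝ) (hy : 0 < y) :
    (α < 1 →
      P.real {ω | y ≤ X ω} ≤ 4 / (α * y ^ α) ∧
      P.real {ω | y < |X ω|} ≤ 8 / (α * y ^ α)) ∧
    1 / (2 * (2 + α * y ^ α)) ≤ P.real {ω | y ≤ X ω} := by
  have hα2 : α ∈ Set.Ioo (0 : ℝ) 2 :=
    hα.elim (fun h => ⟨h.1, by linarith [h.2]⟩) fun h => ⟨by linarith [h.1], h.2⟩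
  obtain ⟨hupper, hlower⟩ :=
    theorem7_general P α hα2 X hX.aemeasurable (hX.isSymmStableLaw_map hα) y hy
  exact ⟨fun h1 => hupper h1.le, hlower⟩
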